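/- Let $\Omega\subset\mathbb{R}^d$ be a bounded open set, and let $\mathrm{Lip}_1(\Omega;\mathbb{R}^d)$ be the set of all $V\colon\Omega\to\mathbb{R}^d$ with $|V(x)-V(y)|\le|x-y|$ for all $x,y\in\Omega$. Such a $V$ is differentiable almost everywhere in $\Omega$; write $DV=(\partial_jV_i)_{ij}$ and $\operatorname{div}V=\operatorname{tr}DV$. It also extends uniquely to a continuous function on $\overline\Omega$, which gives it boundary values. Let $U$ be either $$\Big\{V\in\mathrm{Lip}_1(\Omega;\mathbb{R}^d):\int_\Omega \big(V+\mathrm{id}\,\operatorname{div}V\big)=0\Big\}\quad\text{or}\quad\big\{V\in\mathrm{Lip}_1(\Omega;\mathbb{R}^d):V|_\Sigma=0\big\},$$ where $\Sigma\subset\partial\Omega$ is non-empty. Let $\mathcal S$ be a collection of subsets of $\mathbb{R}^d$ with $\Omega\in\mathcal S$, and let $\mathcal J\colon\mathcal S\to\mathbb{R}$. For $V\in U$ and $t\ge0$ put $\Omega_t(V)=\{x+tV(x):x\in\Omega\}$. Assume that for every $V\in U$ one has $\Omega_t(V)\in\mathcal S$ for all sufficiently small $t\ge0$, that the shape derivative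 $$\mathcal J'(\Omega)[V]:=\lim_{t\to0^+}\frac{\mathcal J(\Omega_t(V))-\mathcal J(\Omega)}{t}$$ exists, and that $$\mathcal J'(\Omega)[V]=\int_\Omega \big(S_1:DV+S_0\cdot V\big),$$ where $S_1\in L^1(\Omega;\mathbb{R}^{d\times d})$ and $S_0\in L^1(\Omega;\mathbb{R}^d)$ do not depend on $V$, and $A:B=\sum_{i,j}A_{ij}B_{ij}$. Then for every $\epsilon>0$ there exists $V^\epsilon\in U$ such that $$\mathcal J'(\Omega)[V^\epsilon]+\frac{\epsilon}{2}\int_\Omega|DV^\epsilon|^2=\inf\Big\{\mathcal J'(\Omega)[V']+\frac{\epsilon}{2}\int_\Omega|DV'|^2 : V'\in U\Big\},$$ where $|A|^2=A:A$. -/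

import Mathlib

open MeasureTheory Filter Topology Set

noncomputable section

namespace ShapeOpt

variable {d : ℕ}

/-- `Lip₁(Ω; ℝ^d)`: the fields that are 1-Lipschitz on `Ω` for the Euclidean distance of `ℝ^d`.
Fields are total functions, but everything below depends on their values on `Ω` only. -/
def LipOne (Ω : Set (EuclideanSpace ℝ (Fin d))) :
    Set (EuclideanSpace ℝ (Fin d) → EuclideanSpace ℝ (Fin d)) :=
  {V | ∀ x ∈ Ω, ∀ y ∈ Ω, ‖V x - V y‖ ≤ ‖x - y‖}

/-- The Jacobian matrix `(DV)_{ij} = ∂_j V_i`. A field that is Lipschitz on an open set is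
differentiable almost everywhere there, and this is its weak derivative. -/
def jacobian (V : EuclideanSpace ℝ (Fin d) → EuclideanSpace ℝ (Fin d))
    (x : EuclideanSpace ℝ (Fin d)) : Matrix (Fin d) (Fin d) ℝ :=
  Matrix.of fun i j => (fderiv ℝ V x (EuclideanSpace.single j 1)) i

/-- The divergence, i.e. the trace of the Jacobian matrix. -/
def divergence (V : EuclideanSpace ℝ (Fin d) → EuclideanSpace ℝ (Fin d))
    (x : EuclideanSpace ℝ (Fin d)) : ℝ :=
  (jacobian V x).trace

/-- The contraction `A : B = ∑ᵢⱼ Aᵢⱼ Bᵢⱼ`; so `A : A = |A|²` is the squared Euclidean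
(Frobenius) norm. -/
def contraction (A B : Matrix (Fin d) (Fin d) ℝ) : ℝ :=
  ∑ i, ∑ j, A i j * B i j

/-- The deformed domain `Ω_t(V) = {x + t V(x) : x ∈ Ω}`. -/
def deformed (Ω : Set (EuclideanSpace ℝ (Fin d)))
    (V : EuclideanSpace ℝ (Fin d) → EuclideanSpace ℝ (Fin d)) (t : ℝ) :
    Set (EuclideanSpace ℝ (Fin d)) :=
  (fun x => x + t • V x) '' Ω

/-- `J`, a functional on the collection `S` of admissible domains, is (semi-)differentiable at `Ω`
in direction `V`, with derivative `l`. Only the values of `J` on `S` matter. -/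
def HasShapeDeriv (S : Set (Set (EuclideanSpace ℝ (Fin d))))
    (J : Set (EuclideanSpace ℝ (Fin d)) → ℝ) (Ω : Set (EuclideanSpace ℝ (Fin d)))
    (V : EuclideanSpace ℝ (Fin d) → EuclideanSpace ℝ (Fin d)) (l : ℝ) : Prop :=
  (∃ τ > 0, ∀ t ∈ Ico (0 : ℝ) τ, deformed Ω V t ∈ S) ∧
    Tendsto (fun t : ℝ => (J (deformed Ω V t) - J Ω) / t) (𝓝[>] 0) (𝓝 l)

/-- The shape derivative `J'(Ω)[V] = lim_{t → 0⁺} (J(Ω_t(V)) - J(Ω)) / t`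
(meaningful where `HasShapeDeriv S J Ω V l` holds for some `l`, and then equal to `l`). -/
def shapeDeriv (J : Set (EuclideanSpace ℝ (Fin d)) → ℝ) (Ω : Set (EuclideanSpace ℝ (Fin d)))
    (V : EuclideanSpace ℝ (Fin d) → EuclideanSpace ℝ (Fin d)) : ℝ :=
  limUnder (𝓝[>] (0 : ℝ)) fun t : ℝ => (J (deformed Ω V t) - J Ω) / t

/-- The fields in `Lip₁(Ω; ℝ^d)` that preserve the centre of mass to first order:
`∫_Ω (V + id div V) = 0`. -/
def barycentricFields (Ω : Set (EuclideanSpace ℝ (Fin d))) :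
    Set (EuclideanSpace ℝ (Fin d) → EuclideanSpace ℝ (Fin d)) :=
  {V | V ∈ LipOne Ω ∧ ∫ x in Ω, (V x + divergence V x • x) = 0}

/-- The fields in `Lip₁(Ω; ℝ^d)` with `V = 0` on `Γ ⊆ ∂Ω`. The boundary values of `V` are those of
its unique continuous extension from `Ω` to the closure of `Ω`. -/
def clampedFields (Ω Γ : Set (EuclideanSpace ℝ (Fin d))) :
    Set (EuclideanSpace ℝ (Fin d) → EuclideanSpace ℝ (Fin d)) :=
  {V | V ∈ LipOne Ω ∧ ∀ x ∈ Γ, Tendsto V (𝓝[Ω] x) (𝓝 0)}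

/-- The viscous functional `J'(Ω)[V] + (ε/2) ∫_Ω |DV|²`. -/
def viscousFunctional (J : Set (EuclideanSpace ℝ (Fin d)) → ℝ)
    (Ω : Set (EuclideanSpace ℝ (Fin d))) (ε : ℝ)
    (V : EuclideanSpace ℝ (Fin d) → EuclideanSpace ℝ (Fin d)) : ℝ :=
  shapeDeriv J Ω V + ε / 2 * ∫ x in Ω, contraction (jacobian V x) (jacobian V x)

end ShapeOpt

end

/-! The direct method. Membership in `U` and the functional see a field only through its values on
the open set `Ω`, so a minimizing sequence may be replaced by extensions to the whole space that
share one Lipschitz constant. The clamping, or the barycentric constraint, bounds these at one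
point, and Arzelà–Ascoli gives a subsequence with a pointwise limit `V`. The Jacobians converge
weakly-* in `L^∞` (`tendsto_integral_lineDeriv_mul`), which is what pairing with `S₁ ∈ L¹` requires.
Hence the shape derivative passes to the limit, and so does the barycentric constraint, whose
coordinates have the same form. The quadratic term is only lower semicontinuous: by convexity it
lies above its tangent at `DV`, which is affine and therefore converges
(`two_mul_setIntegral_contraction_sub_le`). -/

namespace ShapeOpt

/-! ### Compactness of equi-Lipschitz sequences -/

section Compactness

/-- Arzelà–Ascoli for equi-Lipschitz sequences that are bounded at one point. -/
theorem exists_subseq_tendsto_of_lipschitzWith {E F : Type*} [PseudoMetricSpace E] [ProperSpace E]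
    [NormedAddCommGroup F] [ProperSpace F] {C : NNReal} {W : ℕ → E → F}
    (hW : ∀ n, LipschitzWith C (W n)) {x₀ : E} {R : ℝ} (hR : ∀ n, ‖W n x₀‖ ≤ R) :
    ∃ (V : E → F) (s : ℕ → ℕ), StrictMono s ∧ LipschitzWith C V ∧
      ∀ x, Tendsto (fun n => W (s n) x) atTop (𝓝 (V x)) := by
  let S : Set C(E, F) := {f | LipschitzWith C f ∧ ‖f x₀‖ ≤ R}
  have hS : IsCompact S := by
    apply ArzelaAscoli.isCompact_of_equicontinuous
    · have himage : ContinuousMap.toFun '' S = {f | LipschitzWith C f} ∩ {f | ‖f x₀‖ ≤ R} := by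
        ext f
        constructor
        · rintro ⟨g, hg, rfl⟩
          exact hg
        · intro hf
          exact ⟨⟨f, hf.1.continuous⟩, hf, rfl⟩
      rw [himage]
      -- The Lipschitz bound from `x₀` confines each value to a ball, so Tychonoff gives compactness
      -- for pointwise convergence.
      have hbox : IsCompact (univ.pi fun x : E => Metric.closedBall (0 : F) (R + C * dist x x₀)) :=
        isCompact_univ_pi fun x => isCompact_closedBall _ _
      refine hbox.of_isClosed_subset ?_ ?_
      · exact (isClosed_setOfPred_lipschitzWith C).inter
          (isClosed_le (continuous_apply x₀).norm continuous_const)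
      · rintro f ⟨hf, hf₀⟩ x -
        have hx := hf.dist_le_mul x x₀
        rw [dist_eq_norm] at hx
        have := norm_le_norm_add_norm_sub' (f x) (f x₀)
        simp only [mem_ofPred_eq] at hf₀
        rw [mem_closedBall_zero_iff]
        linarith
    · exact (LipschitzWith.uniformEquicontinuous _ C fun f : S => f.2.1).equicontinuous
  obtain ⟨V, hV, s, hs, hlim⟩ := hS.tendsto_subseq
    (x := fun n => (⟨W n, (hW n).continuous⟩ : C(E, F))) fun n => ⟨hW n, hR n⟩
  exact ⟨V, s, hs, hV.1, fun x => ((continuous_eval_const x).tendsto V).comp hlim⟩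

end Compactness

/-! ### Weak-* convergence of derivatives -/

section WeakConvergence

variable {E : Type*} [NormedAddCommGroup E] [NormedSpace ℝ E] [FiniteDimensional ℝ E]
  [MeasurableSpace E] [BorelSpace E] {μ : Measure E} [μ.IsAddHaarMeasure]
  {C : NNReal} {f : ℕ → E → ℝ} {f₀ : E → ℝ}

/-- Integration by parts moves the derivative onto `φ`, leaving only the values of `f n`, to which
dominated convergence applies. -/
theorem tendsto_integral_lineDeriv_mul_of_contDiff (hf : ∀ n, LipschitzWith C (f n))
    (hf₀ : LipschitzWith C f₀) (hlim : ∀ x, Tendsto (fun n => f n x) atTop (𝓝 (f₀ x)))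
    {φ : E → ℝ} (hφ : ContDiff ℝ 1 φ) (hφc : HasCompactSupport φ) (v : E) :
    Tendsto (fun n => ∫ x, lineDeriv ℝ (f n) x v * φ x ∂μ) atTop
      (𝓝 (∫ x, lineDeriv ℝ f₀ x v * φ x ∂μ)) := by
  obtain ⟨D, hD⟩ := hφ.lipschitzWith_of_hasCompactSupport hφc one_ne_zero
  simp_rw [fun n => (hf n).integral_lineDeriv_mul_eq (μ := μ) hD hφc v,
    hf₀.integral_lineDeriv_mul_eq (μ := μ) hD hφc v]
  obtain ⟨R, hR⟩ := (hlim 0).norm.bddAbove_range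
  have hderiv : (fun x => lineDeriv ℝ φ x (-v)) = fun x => fderiv ℝ φ x (-v) := by
    ext x
    exact (hφ.differentiable one_ne_zero x).lineDeriv_eq_fderiv
  have hcont : Continuous fun x => lineDeriv ℝ φ x (-v) := by
    rw [hderiv]
    exact (hφ.continuous_fderiv one_ne_zero).clm_apply continuous_const
  have hsupp : HasCompactSupport fun x => lineDeriv ℝ φ x (-v) := by
    rw [hderiv]
    exact hφc.fderiv_apply ℝ (-v)
  refine tendsto_integral_of_dominated_convergence
    (fun x => ‖lineDeriv ℝ φ x (-v)‖ * (R + C * ‖x‖)) ?_ ?_ ?_ ?_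
  · exact fun n => (hcont.mul (hf n).continuous).aestronglyMeasurable
  · exact (hcont.norm.mul (by fun_prop)).integrable_of_hasCompactSupport hsupp.norm.mul_right
  · intro n
    refine .of_forall fun x => ?_
    rw [norm_mul]
    gcongr
    have h₁ := (hf n).dist_le_mul x 0
    have h₂ : ‖f n 0‖ ≤ R := hR ⟨n, rfl⟩
    rw [dist_eq_norm, dist_zero_right] at h₁
    linarith [norm_le_norm_add_norm_sub' (f n x) (f n 0)]
  · exact .of_forall fun x => (hlim x).const_mul _

/-- The line derivatives of equi-Lipschitz functions converging pointwise converge weakly-*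
in `L^∞`. -/
theorem tendsto_integral_lineDeriv_mul (hf : ∀ n, LipschitzWith C (f n))
    (hf₀ : LipschitzWith C f₀) (hlim : ∀ x, Tendsto (fun n => f n x) atTop (𝓝 (f₀ x)))
    {g : E → ℝ} (hg : Integrable g μ) (v : E) :
    Tendsto (fun n => ∫ x, lineDeriv ℝ (f n) x v * g x ∂μ) atTop
      (𝓝 (∫ x, lineDeriv ℝ f₀ x v * g x ∂μ)) := by
  rw [Metric.tendsto_atTop]
  intro η hη
  set K : ℝ := C * ‖v‖
  have hK : 0 ≤ K := by positivity
  -- Smooth compactly supported functions are dense in `L¹`, and the line derivatives are uniformly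
  -- bounded by `K`. The `+ 1` covers `K = 0`.
  obtain ⟨φ, hφc, hφ, hφg⟩ := (memLp_one_iff_integrable.2 hg).exist_eLpNorm_sub_le
    ENNReal.one_ne_top le_rfl (show 0 < η / (3 * (K + 1)) by positivity)
  have hφi : Integrable φ μ := hφ.continuous.integrable_of_hasCompactSupport hφc
  have hgφ : ∫ x, ‖g x - φ x‖ ∂μ ≤ η / (3 * (K + 1)) := by
    rw [integral_norm_eq_lintegral_enorm (f := fun x => g x - φ x)
      (hg.sub hφi).aestronglyMeasurable]
    rw [eLpNorm_one_eq_lintegral_enorm] at hφg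
    exact ENNReal.toReal_le_of_le_ofReal (by positivity) hφg
  have hbound : ∀ h : E → ℝ, LipschitzWith C h →
      dist (∫ x, lineDeriv ℝ h x v * g x ∂μ) (∫ x, lineDeriv ℝ h x v * φ x ∂μ) ≤ η / 3 := by
    intro h hh
    have hmul : ∀ k : E → ℝ, Integrable k μ → Integrable (fun x => lineDeriv ℝ h x v * k x) μ :=
      fun k hk => hk.bdd_mul (hh.memLp_lineDeriv v).aestronglyMeasurable
        (.of_forall fun x => norm_lineDeriv_le_of_lipschitz ℝ hh)
    rw [dist_eq_norm, ← integral_sub (hmul g hg) (hmul φ hφi)]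
    calc ‖∫ x, (lineDeriv ℝ h x v * g x - lineDeriv ℝ h x v * φ x) ∂μ‖
        ≤ ∫ x, K * ‖g x - φ x‖ ∂μ := by
          refine norm_integral_le_of_norm_le ((hg.sub hφi).norm.const_mul K)
            (.of_forall fun x => ?_)
          rw [← mul_sub, norm_mul]
          gcongr
          exact norm_lineDeriv_le_of_lipschitz ℝ hh
      _ = K * ∫ x, ‖g x - φ x‖ ∂μ := integral_const_mul _ _
      _ ≤ (K + 1) * (η / (3 * (K + 1))) := by gcongr; linarith
      _ = η / 3 := by field_simp
  obtain ⟨N, hN⟩ := Metric.tendsto_atTop.1 (tendsto_integral_lineDeriv_mul_of_contDiff (μ := μ)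
    hf hf₀ hlim (hφ.of_le (by exact_mod_cast le_top)) hφc v) (η / 3) (by positivity)
  refine ⟨N, fun n hn => ?_⟩
  have h₁ := hbound _ (hf n)
  have h₂ := hbound _ hf₀
  rw [dist_comm] at h₂
  have h₃ := hN n hn
  have := dist_triangle4 (∫ x, lineDeriv ℝ (f n) x v * g x ∂μ)
    (∫ x, lineDeriv ℝ (f n) x v * φ x ∂μ) (∫ x, lineDeriv ℝ f₀ x v * φ x ∂μ)
    (∫ x, lineDeriv ℝ f₀ x v * g x ∂μ)
  linarith

end WeakConvergence

end ShapeOpt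

namespace ShapeOpt

variable {d : ℕ} {C : NNReal} {Ω : Set (EuclideanSpace ℝ (Fin d))}
  {V : EuclideanSpace ℝ (Fin d) → EuclideanSpace ℝ (Fin d)}
  {W : ℕ → EuclideanSpace ℝ (Fin d) → EuclideanSpace ℝ (Fin d)}

/-! ### Jacobians of Lipschitz fields and the quadratic term -/

section Jacobian

theorem _root_.LipschitzWith.euclidean_apply (hV : LipschitzWith C V) (i : Fin d) :
    LipschitzWith C fun x => V x i :=
  LipschitzWith.of_dist_le_mul fun x y =>
    ((dist_eq_norm (V x i) (V y i)).trans_le (PiLp.norm_apply_le (V x - V y) i)).trans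
      ((dist_eq_norm (V x) (V y)).ge.trans (hV.dist_le_mul x y))

theorem norm_jacobian_le (hV : LipschitzWith C V) (x : EuclideanSpace ℝ (Fin d)) (i j : Fin d) :
    ‖jacobian V x i j‖ ≤ C := by
  calc ‖jacobian V x i j‖ ≤ ‖fderiv ℝ V x (EuclideanSpace.single j 1)‖ := PiLp.norm_apply_le _ i
    _ ≤ ‖fderiv ℝ V x‖ * ‖EuclideanSpace.single j (1 : ℝ)‖ := ContinuousLinearMap.le_opNorm _ _
    _ ≤ C := by simpa using norm_fderiv_le_of_lipschitz ℝ hV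

theorem measurable_jacobian (V : EuclideanSpace ℝ (Fin d) → EuclideanSpace ℝ (Fin d))
    (i j : Fin d) : Measurable fun x => jacobian V x i j :=
  (EuclideanSpace.proj i : EuclideanSpace ℝ (Fin d) →L[ℝ] ℝ).continuous.measurable.comp
    (measurable_fderiv_apply_const ℝ V (EuclideanSpace.single j 1))

theorem jacobian_ae_eq_lineDeriv (hV : LipschitzWith C V) (i j : Fin d) :
    ∀ᵐ x, jacobian V x i j = lineDeriv ℝ (fun y => V y i) x (EuclideanSpace.single j 1) := by
  filter_upwards [hV.ae_differentiableAt] with x hx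
  have h : HasFDerivAt (fun y => V y i) ((EuclideanSpace.proj i).comp (fderiv ℝ V x)) x :=
    (EuclideanSpace.proj i : EuclideanSpace ℝ (Fin d) →L[ℝ] ℝ).hasFDerivAt.comp x hx.hasFDerivAt
  rw [h.differentiableAt.lineDeriv_eq_fderiv, h.fderiv]
  rfl

theorem integrableOn_mul_jacobian (hV : LipschitzWith C V) {g : EuclideanSpace ℝ (Fin d) → ℝ}
    (hg : IntegrableOn g Ω) (i j : Fin d) : IntegrableOn (fun x => g x * jacobian V x i j) Ω :=
  Integrable.mul_bdd (c := C) hg (measurable_jacobian V i j).aestronglyMeasurable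
    (.of_forall fun x => norm_jacobian_le hV x i j)

theorem tendsto_setIntegral_mul_jacobian (hΩ : MeasurableSet Ω)
    (hW : ∀ n, LipschitzWith C (W n)) (hV : LipschitzWith C V)
    (hlim : ∀ x, Tendsto (fun n => W n x) atTop (𝓝 (V x)))
    {g : EuclideanSpace ℝ (Fin d) → ℝ} (hg : IntegrableOn g Ω) (i j : Fin d) :
    Tendsto (fun n => ∫ x in Ω, g x * jacobian (W n) x i j) atTop
      (𝓝 (∫ x in Ω, g x * jacobian V x i j)) := by
  have key : ∀ {h : EuclideanSpace ℝ (Fin d) → EuclideanSpace ℝ (Fin d)}, LipschitzWith C h →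
      ∫ x in Ω, g x * jacobian h x i j =
        ∫ x, lineDeriv ℝ (fun y => h y i) x (EuclideanSpace.single j 1) * Ω.indicator g x := by
    intro h hh
    rw [← integral_indicator hΩ]
    refine integral_congr_ae ?_
    filter_upwards [jacobian_ae_eq_lineDeriv hh i j] with x hx
    by_cases hxΩ : x ∈ Ω <;> simp [hxΩ, hx, mul_comm]
  simp_rw [fun n => key (hW n), key hV]
  exact tendsto_integral_lineDeriv_mul (fun n => (hW n).euclidean_apply i) (hV.euclidean_apply i)
    (fun x => ((EuclideanSpace.proj i : EuclideanSpace ℝ (Fin d) →L[ℝ] ℝ).continuous.tendsto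
      (V x)).comp (hlim x)) (hg.integrable_indicator hΩ) _

theorem integrableOn_contraction_jacobian (hV : LipschitzWith C V)
    {A : EuclideanSpace ℝ (Fin d) → Matrix (Fin d) (Fin d) ℝ}
    (hA : ∀ i j, IntegrableOn (fun x => A x i j) Ω) :
    IntegrableOn (fun x => contraction (A x) (jacobian V x)) Ω :=
  integrable_finsetSum _ fun i _ => integrable_finsetSum _ fun j _ =>
    integrableOn_mul_jacobian hV (hA i j) i j

theorem setIntegral_contraction_jacobian (hV : LipschitzWith C V)
    {A : EuclideanSpace ℝ (Fin d) → Matrix (Fin d) (Fin d) ℝ}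
    (hA : ∀ i j, IntegrableOn (fun x => A x i j) Ω) :
    ∫ x in Ω, contraction (A x) (jacobian V x) =
      ∑ i, ∑ j, ∫ x in Ω, A x i j * jacobian V x i j := by
  have h := fun i j => integrableOn_mul_jacobian hV (hA i j) i j
  simp only [contraction]
  rw [integral_finsetSum _ fun i _ => integrable_finsetSum _ fun j _ => h i j]
  exact Finset.sum_congr rfl fun i _ => integral_finsetSum _ fun j _ => h i j

theorem tendsto_setIntegral_contraction_jacobian (hΩ : MeasurableSet Ω)
    (hW : ∀ n, LipschitzWith C (W n)) (hV : LipschitzWith C V)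
    (hlim : ∀ x, Tendsto (fun n => W n x) atTop (𝓝 (V x)))
    {A : EuclideanSpace ℝ (Fin d) → Matrix (Fin d) (Fin d) ℝ}
    (hA : ∀ i j, IntegrableOn (fun x => A x i j) Ω) :
    Tendsto (fun n => ∫ x in Ω, contraction (A x) (jacobian (W n) x)) atTop
      (𝓝 (∫ x in Ω, contraction (A x) (jacobian V x))) := by
  simp_rw [fun n => setIntegral_contraction_jacobian (hW n) hA,
    setIntegral_contraction_jacobian hV hA]
  exact tendsto_finsetSum _ fun i _ => tendsto_finsetSum _ fun j _ =>
    tendsto_setIntegral_mul_jacobian hΩ hW hV hlim (hA i j) i j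

theorem integrableOn_jacobian (hΩb : Bornology.IsBounded Ω) (hV : LipschitzWith C V)
    (i j : Fin d) : IntegrableOn (fun x => jacobian V x i j) Ω :=
  IntegrableOn.of_bound hΩb.measure_lt_top (measurable_jacobian V i j).aestronglyMeasurable C
    (.of_forall fun x => norm_jacobian_le hV x i j)

/-- Expand `|A - B|² ≥ 0`. -/
theorem two_mul_contraction_sub_le (A B : Matrix (Fin d) (Fin d) ℝ) :
    2 * contraction A B - contraction A A ≤ contraction B B := by
  simp only [contraction, Finset.mul_sum, ← Finset.sum_sub_distrib]
  refine Finset.sum_le_sum fun i _ => Finset.sum_le_sum fun j _ => ?_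
  nlinarith [sq_nonneg (A i j - B i j)]

theorem two_mul_setIntegral_contraction_sub_le (hΩb : Bornology.IsBounded Ω)
    {V' : EuclideanSpace ℝ (Fin d) → EuclideanSpace ℝ (Fin d)}
    (hV : LipschitzWith C V) (hV' : LipschitzWith C V') :
    2 * (∫ x in Ω, contraction (jacobian V x) (jacobian V' x)) -
        ∫ x in Ω, contraction (jacobian V x) (jacobian V x) ≤
      ∫ x in Ω, contraction (jacobian V' x) (jacobian V' x) := by
  have h₁ := integrableOn_contraction_jacobian hV (integrableOn_jacobian hΩb hV)
  have h₂ := integrableOn_contraction_jacobian hV' (integrableOn_jacobian hΩb hV)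
  have h₃ := integrableOn_contraction_jacobian hV' (integrableOn_jacobian hΩb hV')
  rw [← integral_const_mul, ← integral_sub (h₂.const_mul 2) h₁]
  exact integral_mono ((h₂.const_mul 2).sub h₁) h₃ fun x => two_mul_contraction_sub_le _ _

end Jacobian

/-! ### The zeroth-order term -/

section PointwiseLimits

theorem exists_norm_le_on (hΩb : Bornology.IsBounded Ω) (hW : ∀ n, LipschitzWith C (W n))
    (hlim : ∀ x, Tendsto (fun n => W n x) atTop (𝓝 (V x))) :
    ∃ M, ∀ n, ∀ x ∈ Ω, ‖W n x‖ ≤ M := by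
  obtain ⟨R, hR⟩ := (hlim 0).norm.bddAbove_range
  obtain ⟨r, hr⟩ := hΩb.exists_norm_le
  refine ⟨R + C * r, fun n x hx => ?_⟩
  have h₁ := (hW n).dist_le_mul x 0
  have h₂ : ‖W n 0‖ ≤ R := hR ⟨n, rfl⟩
  rw [dist_eq_norm, dist_zero_right] at h₁
  have := mul_le_mul_of_nonneg_left (hr x hx) C.coe_nonneg
  linarith [norm_le_norm_add_norm_sub' (W n x) (W n 0)]

theorem integrableOn_of_lipschitzWith (hΩb : Bornology.IsBounded Ω) (hV : LipschitzWith C V) :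
    IntegrableOn V Ω :=
  (hV.continuous.continuousOn.integrableOn_compact
    hΩb.isCompact_closure).mono_set subset_closure

theorem integrableOn_inner (hΩ : MeasurableSet Ω) (hΩb : Bornology.IsBounded Ω)
    (hV : LipschitzWith C V)
    {S₀ : EuclideanSpace ℝ (Fin d) → EuclideanSpace ℝ (Fin d)} (hS₀ : IntegrableOn S₀ Ω) :
    IntegrableOn (fun x => inner ℝ (S₀ x) (V x)) Ω := by
  obtain ⟨M, hM⟩ := exists_norm_le_on hΩb (fun _ : ℕ => hV) fun x => tendsto_const_nhds
  refine Integrable.mono' (hS₀.norm.mul_const M)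
    (hS₀.aestronglyMeasurable.inner hV.continuous.aestronglyMeasurable) ?_
  filter_upwards [ae_restrict_mem hΩ] with x hx
  exact (norm_inner_le_norm _ _).trans (by gcongr; exact hM 0 x hx)

theorem tendsto_setIntegral_inner (hΩ : MeasurableSet Ω) (hΩb : Bornology.IsBounded Ω)
    (hW : ∀ n, LipschitzWith C (W n))
    (hlim : ∀ x, Tendsto (fun n => W n x) atTop (𝓝 (V x)))
    {S₀ : EuclideanSpace ℝ (Fin d) → EuclideanSpace ℝ (Fin d)} (hS₀ : IntegrableOn S₀ Ω) :
    Tendsto (fun n => ∫ x in Ω, inner ℝ (S₀ x) (W n x)) atTop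
      (𝓝 (∫ x in Ω, inner ℝ (S₀ x) (V x))) := by
  obtain ⟨M, hM⟩ := exists_norm_le_on hΩb hW hlim
  refine tendsto_integral_of_dominated_convergence (fun x => ‖S₀ x‖ * M)
    (fun n => hS₀.aestronglyMeasurable.inner (hW n).continuous.aestronglyMeasurable)
    (hS₀.norm.mul_const M) (fun n => ?_) (.of_forall fun x => tendsto_const_nhds.inner (hlim x))
  filter_upwards [ae_restrict_mem hΩ] with x hx
  exact (norm_inner_le_norm _ _).trans (by gcongr; exact hM n x hx)

end PointwiseLimits

end ShapeOpt

namespace ShapeOpt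

variable {d : ℕ} {C : NNReal} {Ω Γ : Set (EuclideanSpace ℝ (Fin d))}
  {V V' : EuclideanSpace ℝ (Fin d) → EuclideanSpace ℝ (Fin d)}
  {W : ℕ → EuclideanSpace ℝ (Fin d) → EuclideanSpace ℝ (Fin d)}

section LinearFunctional

variable {S₁ : EuclideanSpace ℝ (Fin d) → Matrix (Fin d) (Fin d) ℝ}
  {S₀ : EuclideanSpace ℝ (Fin d) → EuclideanSpace ℝ (Fin d)}

theorem tendsto_setIntegral_contraction_add_inner (hΩ : MeasurableSet Ω)
    (hΩb : Bornology.IsBounded Ω) (hS₁ : ∀ i j, IntegrableOn (fun x => S₁ x i j) Ω)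
    (hS₀ : IntegrableOn S₀ Ω)
    (hW : ∀ n, LipschitzWith C (W n)) (hV : LipschitzWith C V)
    (hlim : ∀ x, Tendsto (fun n => W n x) atTop (𝓝 (V x))) :
    Tendsto (fun n => ∫ x in Ω, (contraction (S₁ x) (jacobian (W n) x) + inner ℝ (S₀ x) (W n x)))
      atTop (𝓝 (∫ x in Ω, (contraction (S₁ x) (jacobian V x) + inner ℝ (S₀ x) (V x)))) := by
  simp_rw [fun n => integral_add (integrableOn_contraction_jacobian (hW n) hS₁)
    (integrableOn_inner hΩ hΩb (hW n) hS₀), integral_add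
    (integrableOn_contraction_jacobian hV hS₁) (integrableOn_inner hΩ hΩb hV hS₀)]
  exact (tendsto_setIntegral_contraction_jacobian hΩ hW hV hlim hS₁).add
    (tendsto_setIntegral_inner hΩ hΩb hW hlim hS₀)

end LinearFunctional

/-! ### Dependence on the values on `Ω` only -/

section Congruence

theorem jacobian_eqOn (hΩ : IsOpen Ω) (h : EqOn V V' Ω) : EqOn (jacobian V) (jacobian V') Ω := by
  intro x hx
  simp only [jacobian, (h.eventuallyEq_of_mem (hΩ.mem_nhds hx)).fderiv_eq]

theorem divergence_eqOn (hΩ : IsOpen Ω) (h : EqOn V V' Ω) :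
    EqOn (divergence V) (divergence V') Ω :=
  fun _ hx => congrArg Matrix.trace (jacobian_eqOn hΩ h hx)

theorem viscousFunctional_congr (J : Set (EuclideanSpace ℝ (Fin d)) → ℝ) (ε : ℝ)
    (hΩ : IsOpen Ω) (h : EqOn V V' Ω) :
    viscousFunctional J Ω ε V = viscousFunctional J Ω ε V' := by
  have hdef : ∀ t, deformed Ω V t = deformed Ω V' t := fun t =>
    image_congr fun x hx => by rw [h hx]
  simp only [viscousFunctional, shapeDeriv, hdef]
  congr 2
  exact setIntegral_congr_fun hΩ.measurableSet fun x hx => by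
    simp only [jacobian_eqOn hΩ h hx]

theorem LipOne.congr (hV : V ∈ LipOne Ω) (h : EqOn V V' Ω) : V' ∈ LipOne Ω := by
  intro x hx y hy
  rw [← h hx, ← h hy]
  exact hV x hx y hy

theorem barycentricFields.congr (hΩ : IsOpen Ω) (hV : V ∈ barycentricFields Ω)
    (h : EqOn V V' Ω) : V' ∈ barycentricFields Ω := by
  refine ⟨LipOne.congr hV.1 h, ?_⟩
  rw [← hV.2]
  exact setIntegral_congr_fun hΩ.measurableSet fun x hx => by
    simp only [h hx, divergence_eqOn hΩ h hx]

theorem clampedFields.congr (hV : V ∈ clampedFields Ω Γ) (h : EqOn V V' Ω) :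
    V' ∈ clampedFields Ω Γ :=
  ⟨LipOne.congr hV.1 h, fun x hx => (hV.2 x hx).congr' (h.eventuallyEq_of_mem self_mem_nhdsWithin)⟩

end Congruence

/-! ### Closedness and boundedness of the two families -/

section Closedness

theorem LipOne.of_tendsto (hW : ∀ n, W n ∈ LipOne Ω)
    (hlim : ∀ x, Tendsto (fun n => W n x) atTop (𝓝 (V x))) : V ∈ LipOne Ω := fun x hx y hy =>
  le_of_tendsto ((hlim x).sub (hlim y)).norm (.of_forall fun n => hW n x hx y hy)

theorem clampedFields.apply_eq_zero (hΓ : Γ ⊆ frontier Ω) (hV : V ∈ clampedFields Ω Γ)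
    (hc : Continuous V) {x : EuclideanSpace ℝ (Fin d)} (hx : x ∈ Γ) : V x = 0 := by
  have : (𝓝[Ω] x).NeBot := mem_closure_iff_nhdsWithin_neBot.1 (frontier_subset_closure (hΓ hx))
  exact tendsto_nhds_unique (hc.continuousWithinAt (s := Ω)) (hV.2 x hx)

theorem clampedFields.of_tendsto (hΓ : Γ ⊆ frontier Ω) (hW : ∀ n, LipschitzWith C (W n))
    (hV : LipschitzWith C V) (hlim : ∀ x, Tendsto (fun n => W n x) atTop (𝓝 (V x)))
    (hmem : ∀ n, W n ∈ clampedFields Ω Γ) : V ∈ clampedFields Ω Γ := by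
  refine ⟨LipOne.of_tendsto (fun n => (hmem n).1) hlim, fun x hx => ?_⟩
  have hVx : V x = 0 := by
    refine tendsto_nhds_unique (hlim x) ?_
    simp_rw [fun n => clampedFields.apply_eq_zero hΓ (hmem n) (hW n).continuous hx]
    exact tendsto_const_nhds
  rw [← hVx]
  exact hV.continuous.continuousWithinAt

theorem norm_divergence_le (hV : LipschitzWith C V) (x : EuclideanSpace ℝ (Fin d)) :
    ‖divergence V x‖ ≤ d * C := by
  calc ‖divergence V x‖ = ‖∑ i, jacobian V x i i‖ := rfl
    _ ≤ ∑ i, ‖jacobian V x i i‖ := norm_sum_le _ _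
    _ ≤ ∑ _i : Fin d, (C : ℝ) := Finset.sum_le_sum fun i _ => norm_jacobian_le hV x i i
    _ = d * C := by simp

theorem measurable_divergence (V : EuclideanSpace ℝ (Fin d) → EuclideanSpace ℝ (Fin d)) :
    Measurable (divergence V) := by
  change Measurable fun x => ∑ i, jacobian V x i i
  exact Finset.measurable_sum _ fun i _ => measurable_jacobian V i i

theorem integrableOn_add_divergence_smul (hΩb : Bornology.IsBounded Ω) (hV : LipschitzWith C V) :
    IntegrableOn (fun x => V x + divergence V x • x) Ω :=
  (integrableOn_of_lipschitzWith hΩb hV).add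
    ((integrableOn_of_lipschitzWith hΩb LipschitzWith.id).bdd_smul (d * C : ℝ)
      (measurable_divergence V).aestronglyMeasurable
      (.of_forall fun x => norm_divergence_le hV x))

/-- Puts the constraint in the form `S₁ : DV + S₀ · V`, with `S₁ = x_k I` and `S₀ = e_k`, so that
one convergence lemma serves both purposes. -/
theorem setIntegral_add_divergence_smul_apply (hΩb : Bornology.IsBounded Ω)
    (hV : LipschitzWith C V) (k : Fin d) :
    (∫ x in Ω, (V x + divergence V x • x)) k =
      ∫ x in Ω, (contraction (x k • (1 : Matrix (Fin d) (Fin d) ℝ)) (jacobian V x) +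
        inner ℝ (EuclideanSpace.single k (1 : ℝ)) (V x)) := by
  rw [eval_integral_piLp (integrable_piLp_iff.1 (integrableOn_add_divergence_smul hΩb hV))]
  congr 1 with x
  simp [contraction, Matrix.one_apply, divergence, Matrix.trace, add_comm,
    EuclideanSpace.inner_single_left, mul_comm (x k)]
  exact Finset.sum_mul _ _ _

theorem barycentricFields.of_tendsto (hΩ : MeasurableSet Ω) (hΩb : Bornology.IsBounded Ω)
    (hW : ∀ n, LipschitzWith C (W n))
    (hV : LipschitzWith C V) (hlim : ∀ x, Tendsto (fun n => W n x) atTop (𝓝 (V x)))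
    (hmem : ∀ n, W n ∈ barycentricFields Ω) : V ∈ barycentricFields Ω := by
  refine ⟨LipOne.of_tendsto (fun n => (hmem n).1) hlim, ?_⟩
  ext k
  have hcoord : IntegrableOn (fun x : EuclideanSpace ℝ (Fin d) => x k) Ω :=
    integrable_piLp_iff.1 (integrableOn_of_lipschitzWith hΩb LipschitzWith.id) k
  refine tendsto_nhds_unique (f := fun n => (∫ x in Ω, (W n x + divergence (W n) x • x)) k)
    (l := atTop) ?_ ?_
  · simp_rw [fun n => setIntegral_add_divergence_smul_apply hΩb (hW n) k,
      setIntegral_add_divergence_smul_apply hΩb hV k]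
    refine tendsto_setIntegral_contraction_add_inner hΩ hΩb (fun i j => ?_)
      (integrableOn_const hΩb.measure_lt_top.ne) hW hV hlim
    exact hcoord.mul_const _
  · simp_rw [(hmem _).2]
    exact tendsto_const_nhds

/-- The constraint fixes the translation part: subtracting its zero integral writes `|Ω| V x₀` as
the integral of `V x₀ - V x - (div V) x`. With `Ω` in the ball of radius `r`, the oscillation
contributes `C (r + r)` and the divergence `d C r`. -/
theorem barycentricFields.exists_norm_apply_le (hΩ : IsOpen Ω) (hΩb : Bornology.IsBounded Ω)
    {x₀ : EuclideanSpace ℝ (Fin d)} (hx₀ : x₀ ∈ Ω) (C : NNReal) :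
    ∃ R, ∀ V ∈ barycentricFields Ω, LipschitzWith C V → ‖V x₀‖ ≤ R := by
  obtain ⟨r, hr⟩ := hΩb.exists_norm_le
  refine ⟨C * (r + r) + d * C * r, fun V hV hL => ?_⟩
  have hfin := hΩb.measure_lt_top (μ := volume)
  have hpos : 0 < volume.real Ω :=
    ENNReal.toReal_pos (hΩ.measure_pos volume ⟨x₀, hx₀⟩).ne' hfin.ne
  have hint : ∫ x in Ω, (V x₀ - (V x + divergence V x • x)) = volume.real Ω • V x₀ := by
    rw [integral_sub (integrable_const_iff.2 (.inr ⟨by simpa using hfin⟩)) (integrableOn_add_divergence_smul hΩb hL), hV.2]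
    simp
  have hle := norm_setIntegral_le_of_norm_le_const (μ := volume) hfin
    (f := fun x => V x₀ - (V x + divergence V x • x)) (C := C * (r + r) + d * C * r) (by
      intro x hx
      rw [← sub_sub]
      refine (norm_sub_le _ _).trans (add_le_add ?_ ?_)
      · rw [← dist_eq_norm]
        refine (hL.dist_le_mul _ _).trans ?_
        gcongr
        rw [dist_eq_norm]
        exact (norm_sub_le _ _).trans (add_le_add (hr _ hx₀) (hr _ hx))
      · rw [norm_smul]
        gcongr
        · exact norm_divergence_le hL x
        · exact hr x hx)
  rw [hint, norm_smul, Real.norm_of_nonneg hpos.le, mul_comm] at hle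
  exact le_of_mul_le_mul_right hle hpos

end Closedness

section ZeroField

@[simp]
theorem jacobian_zero : jacobian (0 : EuclideanSpace ℝ (Fin d) → EuclideanSpace ℝ (Fin d)) = 0 := by
  ext x i j
  simp [jacobian]

theorem zero_mem_barycentricFields : 0 ∈ barycentricFields Ω :=
  ⟨fun x _ y _ => by simp, by simp [divergence]⟩

theorem zero_mem_clampedFields : 0 ∈ clampedFields Ω Γ :=
  ⟨fun x _ y _ => by simp, fun x _ => tendsto_const_nhds⟩

end ZeroField

/-! ### Existence of a minimizer -/

section Minimization

/-- The constant may exceed 1, which is harmless: it serves only for compactness, while the bound 1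
is needed on `Ω` alone. -/
theorem LipOne.exists_lipschitzWith (hV : V ∈ LipOne Ω) :
    ∃ V', LipschitzWith (lipschitzExtensionConstant (EuclideanSpace ℝ (Fin d))) V' ∧
      EqOn V V' Ω := by
  have h : LipschitzOnWith 1 V Ω := LipschitzOnWith.of_dist_le_mul fun x hx y hy => by
    simpa [dist_eq_norm] using hV x hx y hy
  simpa using h.extend_finite_dimension

/-- A family of `1`-Lipschitz fields that depends on the values on `Ω` only, is bounded at a point
and is closed under pointwise limits contains a minimizer of the viscous functional. -/
theorem exists_isLeast_viscousFunctional (hΩ : IsOpen Ω) (hΩb : Bornology.IsBounded Ω)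
    {J : Set (EuclideanSpace ℝ (Fin d)) → ℝ}
    {S₁ : EuclideanSpace ℝ (Fin d) → Matrix (Fin d) (Fin d) ℝ}
    {S₀ : EuclideanSpace ℝ (Fin d) → EuclideanSpace ℝ (Fin d)}
    (hS₁ : ∀ i j, IntegrableOn (fun x => S₁ x i j) Ω) (hS₀ : IntegrableOn S₀ Ω)
    {U : Set (EuclideanSpace ℝ (Fin d) → EuclideanSpace ℝ (Fin d))} (hU₀ : 0 ∈ U)
    (hJ : ∀ V ∈ U, shapeDeriv J Ω V =
      ∫ x in Ω, (contraction (S₁ x) (jacobian V x) + inner ℝ (S₀ x) (V x)))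
    (hUL : U ⊆ LipOne Ω) (hUcongr : ∀ V ∈ U, ∀ V', EqOn V V' Ω → V' ∈ U)
    {x₀ : EuclideanSpace ℝ (Fin d)}
    (hUb : ∀ C, ∃ R, ∀ V ∈ U, LipschitzWith C V → ‖V x₀‖ ≤ R)
    (hUc : ∀ (C : NNReal) (W : ℕ → EuclideanSpace ℝ (Fin d) → EuclideanSpace ℝ (Fin d))
      (V : EuclideanSpace ℝ (Fin d) → EuclideanSpace ℝ (Fin d)),
      (∀ n, LipschitzWith C (W n)) → LipschitzWith C V →
      (∀ x, Tendsto (fun n => W n x) atTop (𝓝 (V x))) → (∀ n, W n ∈ U) → V ∈ U)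
    {ε : ℝ} (hε : 0 < ε) :
    ∃ V ∈ U, IsLeast (viscousFunctional J Ω ε '' U) (viscousFunctional J Ω ε V) := by
  set F := viscousFunctional J Ω ε with hF
  set C := lipschitzExtensionConstant (EuclideanSpace ℝ (Fin d))
  -- In `EReal` the infimum exists without a prior lower bound.
  obtain ⟨u, -, hu, huU⟩ := exists_seq_tendsto_sInf (S := (fun V => (F V : EReal)) '' U)
    ⟨_, mem_image_of_mem _ hU₀⟩ (OrderBot.bddBelow _)
  choose v hvU hvu using huU
  choose W hWL hWv using fun n => LipOne.exists_lipschitzWith (hUL (hvU n))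
  have hWU : ∀ n, W n ∈ U := fun n => hUcongr _ (hvU n) _ (hWv n)
  have hWu : ∀ n, (F (W n) : EReal) = u n := fun n => by
    rw [← hvu n]
    exact congrArg _ (viscousFunctional_congr J ε hΩ (hWv n)).symm
  obtain ⟨R, hR⟩ := hUb C
  obtain ⟨V, s, hs, hVL, hlim⟩ :=
    exists_subseq_tendsto_of_lipschitzWith hWL fun n => hR _ (hWU n) (hWL n)
  have hVU : V ∈ U := hUc C _ V (fun n => hWL (s n)) hVL hlim fun n => hWU (s n)
  have hquad := tendsto_setIntegral_contraction_jacobian hΩ.measurableSet (fun n => hWL (s n)) hVL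
    hlim (integrableOn_jacobian hΩb hVL)
  have hlower := (tendsto_setIntegral_contraction_add_inner hΩ.measurableSet hΩb hS₁ hS₀
    (fun n => hWL (s n)) hVL hlim).add (((hquad.const_mul 2).sub_const
      (∫ x in Ω, contraction (jacobian V x) (jacobian V x))).const_mul (ε / 2))
  -- At the limit the tangent touches the quadratic term, so the lower bounds converge to `F V`
  -- itself.
  rw [two_mul (∫ x in Ω, contraction (jacobian V x) (jacobian V x)), add_sub_cancel_right,
    ← hJ V hVU] at hlower
  refine ⟨V, hVU, mem_image_of_mem _ hVU, ?_⟩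
  have hmin : (F V : EReal) ≤ sInf ((fun V => (F V : EReal)) '' U) := by
    refine le_of_tendsto_of_tendsto ((continuous_coe_real_ereal.tendsto _).comp hlower)
      (hu.comp hs.tendsto_atTop) (.of_forall fun n => ?_)
    simp only [Function.comp_apply, ← hWu, EReal.coe_le_coe_iff]
    rw [hF, viscousFunctional, hJ _ (hWU _)]
    gcongr
    exact two_mul_setIntegral_contraction_sub_le hΩb hVL (hWL _)
  rintro _ ⟨V', hV', rfl⟩
  exact EReal.coe_le_coe_iff.1 (hmin.trans (sInf_le (mem_image_of_mem _ hV')))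

end Minimization

end ShapeOpt

theorem proposition2p13 {d : ℕ}
    (Ω : Set (EuclideanSpace ℝ (Fin d))) (hΩo : IsOpen Ω) (hΩb : Bornology.IsBounded Ω)
    (S : Set (Set (EuclideanSpace ℝ (Fin d)))) (hΩS : Ω ∈ S)
    (J : Set (EuclideanSpace ℝ (Fin d)) → ℝ)
    (S₁ : EuclideanSpace ℝ (Fin d) → Matrix (Fin d) (Fin d) ℝ)
    (S₀ : EuclideanSpace ℝ (Fin d) → EuclideanSpace ℝ (Fin d))
    (hS₁ : ∀ i j, IntegrableOn (fun x => S₁ x i j) Ω volume)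
    (hS₀ : IntegrableOn S₀ Ω volume)
    (U : Set (EuclideanSpace ℝ (Fin d) → EuclideanSpace ℝ (Fin d)))
    (hU : U = ShapeOpt.barycentricFields Ω ∨
      ∃ Γ : Set (EuclideanSpace ℝ (Fin d)), Γ ⊆ frontier Ω ∧ Γ.Nonempty ∧
        U = ShapeOpt.clampedFields Ω Γ)
    (hJ : ∀ V ∈ U, ShapeOpt.HasShapeDeriv S J Ω V
      (∫ x in Ω, (ShapeOpt.contraction (S₁ x) (ShapeOpt.jacobian V x) + inner ℝ (S₀ x) (V x))))
    (ε : ℝ) (hε : 0 < ε) :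
    ∃ Vε ∈ U, IsLeast (ShapeOpt.viscousFunctional J Ω ε '' U)
      (ShapeOpt.viscousFunctional J Ω ε Vε) := by
  have hJ' := fun V hV => (hJ V hV).2.limUnder_eq
  rcases hU with rfl | ⟨Γ, hΓ, ⟨x₀, hx₀⟩, rfl⟩
  -- An empty `Ω` offers no base point, but then all fields agree on it. In the clamped case the
  -- base point lies in `Γ`.
  · rcases Ω.eq_empty_or_nonempty with rfl | ⟨x₀, hx₀⟩
    · refine ⟨0, ShapeOpt.zero_mem_barycentricFields,
        mem_image_of_mem _ ShapeOpt.zero_mem_barycentricFields, ?_⟩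
      rintro _ ⟨V, -, rfl⟩
      exact (ShapeOpt.viscousFunctional_congr J ε isOpen_empty (eqOn_empty 0 V)).le
    · exact ShapeOpt.exists_isLeast_viscousFunctional hΩo hΩb hS₁ hS₀
        ShapeOpt.zero_mem_barycentricFields hJ' (fun V hV => hV.1)
        (fun V hV V' h => ShapeOpt.barycentricFields.congr hΩo hV h)
        (ShapeOpt.barycentricFields.exists_norm_apply_le hΩo hΩb hx₀)
        (fun C W V hW hV hlim hmem =>
          ShapeOpt.barycentricFields.of_tendsto hΩo.measurableSet hΩb hW hV hlim hmem) hε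
  · exact ShapeOpt.exists_isLeast_viscousFunctional hΩo hΩb hS₁ hS₀
      ShapeOpt.zero_mem_clampedFields hJ' (fun V hV => hV.1)
      (fun V hV V' h => ShapeOpt.clampedFields.congr hV h) (x₀ := x₀)
      (fun C => ⟨0, fun V hV hL => by
        rw [ShapeOpt.clampedFields.apply_eq_zero hΓ hV hL.continuous hx₀, norm_zero]⟩)
      (fun C W V hW hV hlim hmem => ShapeOpt.clampedFields.of_tendsto hΓ hW hV hlim hmem) hε
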